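/- Tensor fields on $\mathbb R^3$ are smooth and given by Cartesian components; indices are moved with the Euclidean metric $g_{ij}=\delta_{ij}$, $D_i=\partial_i$, $\Delta=\partial_i\partial^i$, $\epsilon_{ijk}$ is the totally antisymmetric symbol, and round brackets denote symmetrisation with weight one. A tensor field $h_{ij}$ is called TT if $h_{ij}=h_{ji}$, $h^i{}_i=0$ and $\partial_i h^i{}_j=0$. For a symmetric trace-free $u_{ij}$ put $$P(u)_{m\ell}=\tfrac12\,\epsilon_m{}^{ij}\,\partial_i\Big(\Delta u_{j\ell}-2\,\partial_{(\ell}D^n u_{j)n}+\tfrac12\, g_{j\ell}\,D^nD^k u_{nk}\Big).$$ Let $(h_{ij},k_{ij})$ be linearised vacuum initial data on $\mathbb R^3$ in TT gauge, that is, $h_{ij}$ and $k_{ij}$ are TT. Let $\Omega\subset\mathbb R^3$ be open and let $\widetilde\Omega$ be an open set containing $\overline\Omega$. Then: (a) There are smooth symmetric trace-free tensor fields $u_{ij},v_{ij}$ (third-order potentials) with $h=P(u)$ and $k=P(v)$. (b) There is a smooth function $\chi$ on $\mathbb R^3$ with $\chi=1$ on $\Omega$ and $\operatorname{supp}\chi\subset\widetilde\Omega$,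 where $\operatorname{supp}\chi$ is the closure of $\{\chi\ne0\}$. (c) Let $u,v$ be any smooth symmetric trace-free tensor fields with $h=P(u)$ and $k=P(v)$, and let $\chi$ be any smooth function with $\chi=1$ on $\Omega$ and $\chi=0$ outside $\widetilde\Omega$. Put $\tilde h=P(\chi u)$ and $\tilde k=P(\chi v)$. Then $\tilde h$ and $\tilde k$ are TT on all of $\mathbb R^3$, and $(\tilde h,\tilde k)$ satisfies the linearised vacuum constraint equations $$\Delta \tilde h^i{}_i=\partial_i\partial_j\tilde h^{ij},\qquad \partial_j\big(\tilde k^j{}_i-\tilde k^l{}_l\,\delta^j_i\big)=0$$ everywhere. Moreover $(\tilde h,\tilde k)=(h,k)$ on $\Omega$. Finally, $(\tilde h,\tilde k)$ vanishes on the closure of $\mathbb R^3\setminus\overline{\widetilde\Omega}$, and if $\operatorname{supp}\chi\subset\widetilde\Omega$, then $(\tilde h,\tilde k)$ vanishes everywhere outside $\widetilde\Omega$. -/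

import Mathlib

open scoped ContDiff

noncomputable section

namespace Shielding

/-- Three-dimensional Euclidean space with its Cartesian coordinates `x 0, x 1, x 2`. -/
abbrev E3 : Type := EuclideanSpace ℝ (Fin 3)

/-- A two-index tensor field on `E3`, given by its Cartesian components. Since the background metric
is the Euclidean one, upper and lower indices are not distinguished. -/
abbrev TensorField : Type := Fin 3 → Fin 3 → E3 → ℝ

/-- The Cartesian partial derivative `∂ᵢ f`. -/
def pd (i : Fin 3) (f : E3 → ℝ) : E3 → ℝ :=
  fun x => fderiv ℝ f x (EuclideanSpace.single i 1)

/-- The flat Laplacian. -/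
def laplacian (f : E3 → ℝ) : E3 → ℝ :=
  fun x => ∑ i, pd i (pd i f) x

/-- The Kronecker symbol, that is, the components of the Euclidean metric. -/
def delta (i j : Fin 3) : ℝ := if i = j then 1 else 0

/-- The totally antisymmetric symbol `ε_{ijk}` with `ε_{012} = 1`. -/
def eps (i j k : Fin 3) : ℝ :=
  (((i : ℕ) : ℝ) - ((j : ℕ) : ℝ)) * (((j : ℕ) : ℝ) - ((k : ℕ) : ℝ)) *
    (((k : ℕ) : ℝ) - ((i : ℕ) : ℝ)) / 2

/-- The trace `h^k_k`. -/
def tr (h : TensorField) : E3 → ℝ := fun x => ∑ k, h k k x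

/-- The divergence on the first index, `∂_i h^i_j`. -/
def div (h : TensorField) (j : Fin 3) : E3 → ℝ := fun x => ∑ i, pd i (h i j) x

/-- The double divergence `∂_i ∂_j h^{ij}`. -/
def divdiv (h : TensorField) : E3 → ℝ := fun x => ∑ i, ∑ j, pd i (pd j (h i j)) x

/-- Smooth symmetric trace-free tensor fields. -/
structure IsSymTraceFree (u : TensorField) : Prop where
  smooth : ∀ i j, ContDiff ℝ ∞ (u i j)
  symm : ∀ i j x, u i j x = u j i x
  traceFree : ∀ x, tr u x = 0

/-- Smooth symmetric, transverse and traceless (TT) tensor fields. -/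
structure IsTT (h : TensorField) : Prop extends IsSymTraceFree h where
  transverse : ∀ j x, div h j x = 0

/-- The linearised vacuum initial data `h_{ij}`, `k_{ij} = ∂₀ h_{ij}` in a gauge with `h_{0i} = 0`:
smooth symmetric tensor fields that satisfy the linearised scalar constraint
`Δ h^i_i = ∂_i ∂_j h^{ij}` and the linearised vector constraint `∂_j (k^j_i - k^l_l δ^j_i) = 0`. -/
structure IsLinearisedVacuumData (h k : TensorField) : Prop where
  smooth_h : ∀ i j, ContDiff ℝ ∞ (h i j)
  smooth_k : ∀ i j, ContDiff ℝ ∞ (k i j)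
  symm_h : ∀ i j x, h i j x = h j i x
  symm_k : ∀ i j x, k i j x = k j i x
  scalarConstraint : ∀ x, laplacian (tr h) x = divdiv h x
  vectorConstraint : ∀ i x, div (fun j l y => k j l y - tr k y * delta j l) i x = 0

/-- The second-order expression under the curl in the operator `P`:
`Δ u_{jl} - 2 ∂_{(l} D^n u_{j)n} + ½ g_{jl} D^n D^k u_{nk}`,
where `2 A_{(jl)} = A_{jl} + A_{lj}`. -/
def secondOrderPart (u : TensorField) : TensorField := fun j l x =>
  laplacian (u j l) x
    - (pd l (fun y => ∑ n, pd n (u j n) y) x + pd j (fun y => ∑ n, pd n (u l n) y) x)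
    + 1 / 2 * delta j l * divdiv u x

/-- The third-order operator
`P(u)_{ml} = ½ ε_m^{ij} ∂_i (Δ u_{jl} - 2 ∂_{(l} D^n u_{j)n} + ½ g_{jl} D^n D^k u_{nk})`. -/
def P (u : TensorField) : TensorField := fun m l x =>
  1 / 2 * ∑ i, ∑ j, eps m i j * pd i (secondOrderPart u j l) x

/-- The product `χ u` of a function and a tensor field. -/
def cutoff (χ : E3 → ℝ) (u : TensorField) : TensorField := fun i j x => χ x * u i j x

end Shielding

end

/-! Up to a constant, `P` is the linearised Cotton–York operator. For symmetric trace-free `u`, the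
second-order part `S` is `-2` times the linearised Schouten tensor of `u`, and `P u` is half its
curl. Transversality is div curl = 0, the trace vanishes because `S` is symmetric, and symmetry of
`P u` is the linearised Bianchi identity div S = grad tr S. Hence `P` maps every symmetric
trace-free field to a TT field, including `χ u`; since `P` is also local, the shielding claims
follow.

The substance is surjectivity onto TT fields (`exists_eq_smoothP`). On all of space a
divergence-free field is a curl (`exists_eq_curl`). Applied to columns, with gradients absorbing the
antisymmetric part, this gives h = curl A with `A` symmetric (`exists_symm_eq_curl`). Symmetry of
`h` says that A - (tr A) δ is divergence-free, hence a double curl inc w (`exists_eq_inc`). So `A`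
is a multiple of the linearised Schouten tensor of `w`. The trace of `w` changes it only by a
Hessian, which the outer curl kills, so a multiple of the trace-free part of `w` is a potential for
`h`. -/

/-! ### Smooth dependence of integrals on parameters -/

theorem hasFDerivAt_integral_of_contDiff_prod {E F : Type*} [NormedAddCommGroup E]
    [NormedSpace ℝ E] [ProperSpace E] [NormedAddCommGroup F] [NormedSpace ℝ F]
    {f : E × ℝ → F} (hf : ContDiff ℝ 1 f) (x₀ : E) :
    HasFDerivAt (fun x => ∫ t in (0 : ℝ)..1, f (x, t))
      (∫ t in (0 : ℝ)..1, (fderiv ℝ f (x₀, t)).comp (ContinuousLinearMap.inl ℝ E ℝ)) x₀ := by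
  have hcont : Continuous fun p : E × ℝ =>
      (fderiv ℝ f p).comp (ContinuousLinearMap.inl ℝ E ℝ) :=
    (hf.continuous_fderiv one_ne_zero).clm_comp continuous_const
  -- Compactness of the ball times the unit interval gives a constant dominating the derivative.
  obtain ⟨C, hC⟩ := ((isCompact_closedBall x₀ 1).prod (isCompact_Icc (a := (0 : ℝ))
    (b := 1))).exists_bound_of_continuousOn hcont.continuousOn
  refine (intervalIntegral.hasFDerivAt_integral_of_dominated_of_fderiv_le
    (F' := fun x t => (fderiv ℝ f (x, t)).comp (ContinuousLinearMap.inl ℝ E ℝ))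
    (bound := fun _ => C) (Metric.closedBall_mem_nhds x₀ one_pos) ?_ ?_ ?_ ?_ ?_ ?_)
  · exact Filter.Eventually.of_forall fun x =>
      (hf.continuous.comp (by fun_prop : Continuous fun t : ℝ => (x, t))).aestronglyMeasurable
  · exact (hf.continuous.comp
      (by fun_prop : Continuous fun t : ℝ => (x₀, t))).intervalIntegrable _ _
  · exact (hcont.comp (by fun_prop : Continuous fun t : ℝ => (x₀, t))).aestronglyMeasurable
  · refine Filter.Eventually.of_forall fun t ht x hx => hC (x, t) ⟨hx, ?_⟩
    rw [Set.uIoc_of_le zero_le_one] at ht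
    exact Set.Ioc_subset_Icc_self ht
  · exact intervalIntegrable_const
  · refine Filter.Eventually.of_forall fun t _ x _ => ?_
    exact ((hf.differentiable one_ne_zero) (x, t)).hasFDerivAt.comp x
      (hasFDerivAt_prodMk_left x t)

/-- `F` is quantified inside the induction because each differentiation replaces it by the space of
continuous linear maps from `E` to `F`. -/
theorem contDiff_nat_integral_of_contDiff_prod {E : Type} [NormedAddCommGroup E]
    [NormedSpace ℝ E] [ProperSpace E] (n : ℕ) : ∀ {F : Type} [NormedAddCommGroup F]
    [NormedSpace ℝ F] {f : E × ℝ → F}, ContDiff ℝ ∞ f →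
    ContDiff ℝ n (fun x => ∫ t in (0 : ℝ)..1, f (x, t)) := by
  induction n with
  | zero =>
    intro F _ _ f hf
    exact contDiff_zero.2 (continuous_iff_continuousAt.2 fun x =>
      (hasFDerivAt_integral_of_contDiff_prod (hf.of_le (by simp)) x).continuousAt)
  | succ n ih =>
    intro F _ _ f hf
    have hd := hasFDerivAt_integral_of_contDiff_prod (hf.of_le (by simp))
    rw [Nat.cast_succ, contDiff_succ_iff_fderiv]
    refine ⟨fun x => (hd x).differentiableAt, by simp, ?_⟩
    rw [funext fun x => (hd x).fderiv]
    exact ih (f := fun p => (fderiv ℝ f p).comp (ContinuousLinearMap.inl ℝ E ℝ))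
      ((hf.fderiv_right (by simp)).clm_comp contDiff_const)

theorem contDiff_integral_of_contDiff_prod {E F : Type} [NormedAddCommGroup E]
    [NormedSpace ℝ E] [ProperSpace E] [NormedAddCommGroup F]
    [NormedSpace ℝ F] {f : E × ℝ → F} (hf : ContDiff ℝ ∞ f) :
    ContDiff ℝ ∞ (fun x => ∫ t in (0 : ℝ)..1, f (x, t)) :=
  contDiff_infty.2 fun n => contDiff_nat_integral_of_contDiff_prod n hf

namespace Shielding

noncomputable section

/-! ### Partial derivatives and coordinate primitives -/

theorem contDiff_pd {f : E3 → ℝ} (hf : ContDiff ℝ ∞ f) (i : Fin 3) : ContDiff ℝ ∞ (pd i f) :=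
  (hf.fderiv_right (by simp)).clm_apply contDiff_const

theorem pd_comm {f : E3 → ℝ} (hf : ContDiff ℝ ∞ f) (i j : Fin 3) :
    pd i (pd j f) = pd j (pd i f) := by
  have key : ∀ (i j : Fin 3) x, pd i (pd j f) x =
      fderiv ℝ (fderiv ℝ f) x (EuclideanSpace.single i 1) (EuclideanSpace.single j 1) := by
    intro i j x
    have hd : DifferentiableAt ℝ (fderiv ℝ f) x :=
      ((hf.fderiv_right (m := ∞) (by simp)).differentiable (by simp)) x
    have := hd.hasFDerivAt.clm_apply
      (hasFDerivAt_const (EuclideanSpace.single j (1 : ℝ)) x)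
    change fderiv ℝ (fun y => fderiv ℝ f y (EuclideanSpace.single j 1)) x _ = _
    rw [this.fderiv]
    simp
  funext x
  rw [key, key]
  exact (hf.contDiffAt.isSymmSndFDerivAt
    (by simpa using WithTop.coe_le_coe.2 (le_top : (2 : ℕ∞) ≤ ⊤))) _ _

/-- The primitive of `f` in the `i`-th coordinate that vanishes on the plane `x i = 0`. -/
def primitive (i : Fin 3) (f : E3 → ℝ) : E3 → ℝ := fun x =>
  x i * ∫ t in (0 : ℝ)..1, f (x + ((t - 1) * x i) • EuclideanSpace.single i 1)

theorem contDiff_coord_shift (i : Fin 3) : ContDiff ℝ ∞ fun p : E3 × ℝ =>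
    p.1 + ((p.2 - 1) * p.1 i) • (EuclideanSpace.single i 1 : E3) := by
  have : ContDiff ℝ ∞ fun p : E3 × ℝ => p.1 i :=
    (EuclideanSpace.proj (𝕜 := ℝ) i).contDiff.comp contDiff_fst
  fun_prop

theorem contDiff_primitive {f : E3 → ℝ} (hf : ContDiff ℝ ∞ f) (i : Fin 3) :
    ContDiff ℝ ∞ (primitive i f) :=
  (EuclideanSpace.proj (𝕜 := ℝ) i).contDiff.mul
    (contDiff_integral_of_contDiff_prod (hf.comp (contDiff_coord_shift i)))

theorem primitive_eq_integral (i : Fin 3) (f : E3 → ℝ) (x : E3) :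
    primitive i f x = ∫ r in (0 : ℝ)..x i, f (x + (r - x i) • EuclideanSpace.single i 1) := by
  have := intervalIntegral.mul_integral_comp_mul_left (a := 0) (b := 1)
    (f := fun r => f (x + (r - x i) • EuclideanSpace.single i 1)) (c := x i)
  rw [mul_zero, mul_one] at this
  rw [← this, primitive]
  congr 2
  funext t
  congr 3
  ring

theorem pd_eq_deriv {f : E3 → ℝ} (hf : ContDiff ℝ ∞ f) (i : Fin 3) (x : E3) :
    pd i f x = deriv (fun s : ℝ => f (x + s • EuclideanSpace.single i 1)) 0 :=
  ((hf.differentiable (by simp)) x).lineDeriv_eq_fderiv.symm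

theorem pd_primitive_self {f : E3 → ℝ} (hf : ContDiff ℝ ∞ f) (i : Fin 3) :
    pd i (primitive i f) = f := by
  funext x
  rw [pd_eq_deriv (contDiff_primitive hf i)]
  have h1 : (fun s : ℝ => primitive i f (x + s • EuclideanSpace.single i 1)) = fun s =>
      ∫ r in (0 : ℝ)..(x i + s), f (x + (r - x i) • EuclideanSpace.single i 1) := by
    funext s
    rw [primitive_eq_integral]
    have : (x + s • EuclideanSpace.single i 1 : E3) i = x i + s := by simp
    rw [this]
    congr 1
    funext r
    rw [add_assoc, ← add_smul]
    congr 3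
    ring
  have hc : Continuous fun r : ℝ => f (x + (r - x i) • EuclideanSpace.single i 1) :=
    hf.continuous.comp (by fun_prop)
  have h2 := (hc.integral_hasStrictDerivAt 0 (x i + 0)).hasDerivAt.comp_const_add (x i) 0
  rw [h1, h2.deriv]
  simp

/-- Neither the prefactor `x i` nor the shift along the `i`-th axis depends on `x j`, so
differentiation passes straight to `f` under the integral. -/
theorem pd_primitive_of_ne {f : E3 → ℝ} (hf : ContDiff ℝ ∞ f) {i j : Fin 3} (hij : j ≠ i) :
    pd j (primitive i f) = primitive i (pd j f) := by
  funext x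
  have hg := hf.comp (contDiff_coord_shift i)
  have h1 := hasFDerivAt_integral_of_contDiff_prod (hg.of_le (by simp)) x
  have h2 := ((EuclideanSpace.proj (𝕜 := ℝ) i).hasFDerivAt (x := x)).mul h1
  have hint : IntervalIntegrable (fun t : ℝ => (fderiv ℝ (f ∘ fun p : E3 × ℝ =>
      p.1 + ((p.2 - 1) * p.1 i) • (EuclideanSpace.single i 1 : E3)) (x, t)).comp
        (ContinuousLinearMap.inl ℝ E3 ℝ)) MeasureTheory.volume 0 1 := by
    refine Continuous.intervalIntegrable ?_ _ _
    exact (((hg.continuous_fderiv (by simp)).comp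
      (by fun_prop : Continuous fun t : ℝ => (x, t)))).clm_comp continuous_const
  rw [pd, show primitive i f = _ from rfl]
  erw [h2.fderiv]
  have h0 : (EuclideanSpace.single j (1 : ℝ) : E3) i = 0 := by simp [hij.symm]
  simp only [add_apply, smul_apply, PiLp.proj_apply, h0, mul_zero, add_zero, smul_eq_mul]
  rw [primitive, ContinuousLinearMap.intervalIntegral_apply hint]
  congr 1
  refine intervalIntegral.integral_congr fun t _ => ?_
  have h3 : HasFDerivAt (fun p : E3 × ℝ =>
      p.1 + ((p.2 - 1) * p.1 i) • (EuclideanSpace.single i 1 : E3)) _ (x, t) :=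
    ((contDiff_coord_shift i).differentiable (by simp) _).hasFDerivAt
  have h4 : fderiv ℝ (fun p : E3 × ℝ =>
      p.1 + ((p.2 - 1) * p.1 i) • (EuclideanSpace.single i 1 : E3)) (x, t)
      (EuclideanSpace.single j 1, 0) = EuclideanSpace.single j 1 := by
    rw [← ((contDiff_coord_shift i).differentiable (by simp) _).lineDeriv_eq_fderiv, lineDeriv]
    have : (fun s : ℝ => ((x, t) + s • ((EuclideanSpace.single j 1 : E3), (0 : ℝ))).1 +
        ((((x, t) + s • ((EuclideanSpace.single j 1 : E3), (0 : ℝ))).2 - 1) *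
        ((x, t) + s • ((EuclideanSpace.single j 1 : E3), (0 : ℝ))).1 i) •
          (EuclideanSpace.single i 1 : E3)) = fun s : ℝ =>
        (x + ((t - 1) * x i) • EuclideanSpace.single i 1) + s • EuclideanSpace.single j 1 := by
      funext s
      simp [hij.symm]
      abel
    rw [this]
    simpa using (((hasDerivAt_id (0 : ℝ)).smul_const
      (EuclideanSpace.single j (1 : ℝ) : E3)).const_add
        (x + ((t - 1) * x i) • EuclideanSpace.single i 1)).deriv
  rw [ContinuousLinearMap.comp_apply, ContinuousLinearMap.inl_apply,
    fderiv_comp _ (hf.differentiable (by simp) _) h3.differentiableAt,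
    ContinuousLinearMap.comp_apply, h4]
  rfl

/-! ### Smooth functions as a module with commuting derivations -/

/-- The space of smooth functions on `E3`. -/
def smoothFunctions : Submodule ℝ (E3 → ℝ) where
  carrier := {f | ContDiff ℝ ∞ f}
  zero_mem' := (contDiff_const : ContDiff ℝ ∞ fun _ : E3 => (0 : ℝ))
  add_mem' {f g} (hf : ContDiff ℝ ∞ f) (hg : ContDiff ℝ ∞ g) := hf.add hg
  smul_mem' c f (hf : ContDiff ℝ ∞ f) := hf.const_smul c

theorem contDiff_coe (f : smoothFunctions) : ContDiff ℝ ∞ (f : E3 → ℝ) := f.2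

/-- The partial derivative as a linear endomorphism of the space of smooth functions. -/
def D (i : Fin 3) : smoothFunctions →ₗ[ℝ] smoothFunctions where
  toFun f := ⟨pd i f, contDiff_pd f.2 i⟩
  map_add' f g := by
    ext x
    have hf := ((contDiff_coe f).differentiable (by simp)) x
    have hg := ((contDiff_coe g).differentiable (by simp)) x
    change fderiv ℝ (f.1 + g.1) x _ = fderiv ℝ f.1 x _ + fderiv ℝ g.1 x _
    rw [fderiv_add hf hg]
    rfl
  map_smul' c f := by
    ext x
    have hf := ((contDiff_coe f).differentiable (by simp)) x
    change fderiv ℝ (c • f.1) x _ = c • fderiv ℝ f.1 x _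
    rw [fderiv_const_smul hf]
    rfl

theorem coe_D (i : Fin 3) (f : smoothFunctions) : (D i f : E3 → ℝ) = pd i f := rfl

theorem D_comm (i j : Fin 3) (f : smoothFunctions) : D i (D j f) = D j (D i f) :=
  Subtype.ext (pd_comm f.2 i j)

theorem D_one_zero (f : smoothFunctions) : D 1 (D 0 f) = D 0 (D 1 f) := D_comm _ _ _

theorem D_two_zero (f : smoothFunctions) : D 2 (D 0 f) = D 0 (D 2 f) := D_comm _ _ _

theorem D_two_one (f : smoothFunctions) : D 2 (D 1 f) = D 1 (D 2 f) := D_comm _ _ _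

/-- The second clause, that independence of another coordinate is inherited, is what makes the
correction term in `exists_eq_curl` possible. -/
theorem exists_primitive (i : Fin 3) (f : smoothFunctions) :
    ∃ g : smoothFunctions, D i g = f ∧ ∀ j ≠ i, D j f = 0 → D j g = 0 := by
  refine ⟨⟨primitive i f, contDiff_primitive f.2 i⟩, Subtype.ext (pd_primitive_self f.2 i), ?_⟩
  intro j hj h
  refine Subtype.ext ((pd_primitive_of_ne f.2 hj).trans ?_)
  rw [← coe_D, h]
  funext x
  simp [primitive]

/-! ### Exactness for vector and tensor fields -/

/-- A smooth divergence-free vector field on `E3` is a curl. -/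
theorem exists_eq_curl (V : Fin 3 → smoothFunctions) (h : D 0 (V 0) + D 1 (V 1) + D 2 (V 2) = 0) :
    ∃ W : Fin 3 → smoothFunctions, V 0 = D 1 (W 2) - D 2 (W 1) ∧ V 1 = D 2 (W 0) - D 0 (W 2) ∧
      V 2 = D 0 (W 1) - D 1 (W 0) := by
  -- In the gauge `W 2 = 0`, the first two equations are solved by `W 0 = a` and `W 1 = -b`, with `W
  -- 1` free up to a function `g` independent of `x 2`. The third equation fixes `D 0 g`, and div V
  -- = 0 makes such a `g` available.
  obtain ⟨a, ha, -⟩ := exists_primitive 2 (V 1)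
  obtain ⟨b, hb, -⟩ := exists_primitive 2 (V 0)
  obtain ⟨g, hg, hg'⟩ := exists_primitive 0 (V 2 + D 0 b + D 1 a)
  have hz : D 2 g = 0 := by
    refine hg' 2 (by decide) ?_
    simp only [map_add, D_two_zero, D_two_one, ha, hb]
    rw [← h]
    abel
  refine ⟨![a, g - b, 0], ?_, ?_, ?_⟩
  · simp [hz, hb]
  · simp [ha]
  · simp only [Matrix.cons_val, map_sub, hg]
    abel

/-- A symmetric divergence-free tensor field is the double curl of a symmetric tensor field
(exactness of the elasticity complex). -/
theorem exists_eq_inc (E : Fin 3 → Fin 3 → smoothFunctions) (hs : ∀ i j, E i j = E j i)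
    (h : ∀ k, D 0 (E k 0) + D 1 (E k 1) + D 2 (E k 2) = 0) :
    ∃ w : Fin 3 → Fin 3 → smoothFunctions, (∀ i j, w i j = w j i) ∧
      E 0 0 = D 1 (D 1 (w 2 2)) - (2 : ℝ) • D 1 (D 2 (w 1 2)) + D 2 (D 2 (w 1 1)) ∧
      E 1 1 = D 2 (D 2 (w 0 0)) - (2 : ℝ) • D 0 (D 2 (w 0 2)) + D 0 (D 0 (w 2 2)) ∧
      E 2 2 = D 0 (D 0 (w 1 1)) - (2 : ℝ) • D 0 (D 1 (w 0 1)) + D 1 (D 1 (w 0 0)) ∧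
      E 0 1 = D 1 (D 2 (w 0 2)) + D 0 (D 2 (w 1 2)) - D 2 (D 2 (w 0 1)) - D 0 (D 1 (w 2 2)) ∧
      E 0 2 = D 1 (D 2 (w 0 1)) + D 0 (D 1 (w 1 2)) - D 1 (D 1 (w 0 2)) - D 0 (D 2 (w 1 1)) ∧
      E 1 2 = D 0 (D 2 (w 0 1)) + D 0 (D 1 (w 0 2)) - D 0 (D 0 (w 1 2)) - D 1 (D 2 (w 0 0)) := by
  choose C hC0 hC1 hC2 using fun k => exists_eq_curl (E k) (h k)
  have h01 := hs 0 1
  have h02 := hs 0 2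
  have h12 := hs 1 2
  simp only [hC0, hC1, hC2] at h01 h02 h12
  -- With the rows of `E` written as curls of the rows of `C`, symmetry of `E` says exactly that C -
  -- (tr C) δ has divergence-free columns, which are again curls.
  have hdiv : ∀ m, ∃ F : Fin 3 → smoothFunctions,
      C 0 m - (if 0 = m then C 0 0 + C 1 1 + C 2 2 else 0) = D 1 (F 2) - D 2 (F 1) ∧
      C 1 m - (if 1 = m then C 0 0 + C 1 1 + C 2 2 else 0) = D 2 (F 0) - D 0 (F 2) ∧
      C 2 m - (if 2 = m then C 0 0 + C 1 1 + C 2 2 else 0) = D 0 (F 1) - D 1 (F 0) := by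
    intro m
    refine exists_eq_curl
      (fun k => C k m - (if k = m then C 0 0 + C 1 1 + C 2 2 else 0)) ?_
    fin_cases m
    · simp only [Fin.zero_eta, Fin.isValue, ↓reduceIte, map_add, map_sub, one_ne_zero,
        Fin.reduceEq, map_zero]
      linear_combination (norm := module) -(1 : ℝ) • h12
    · simp only [Fin.mk_one, Fin.isValue, ↓reduceIte, map_add, map_sub, zero_ne_one,
        Fin.reduceEq, map_zero]
      linear_combination (norm := module) (1 : ℝ) • h02
    · simp only [Fin.reduceFinMk, Fin.isValue, ↓reduceIte, map_add, map_sub, Fin.reduceEq,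
        map_zero]
      linear_combination (norm := module) -(1 : ℝ) • h01
  choose F hF0 hF1 hF2 using hdiv
  have c01 := hF0 1
  have c02 := hF0 2
  have c10 := hF1 0
  have c12 := hF1 2
  have c20 := hF2 0
  have c21 := hF2 1
  simp only [Fin.isValue, Fin.reduceEq, zero_ne_one, one_ne_zero, ↓reduceIte, sub_zero]
    at c01 c02 c10 c12 c20 c21
  have r0 := hF0 0
  have r1 := hF1 1
  have r2 := hF2 2
  simp only [↓reduceIte] at r0 r1 r2
  -- The trace is removed by inverting C ↦ C - (tr C) δ on the diagonal.
  have c00 : C 0 0 = (1 / 2 : ℝ) • ((D 1 (F 0 2) - D 2 (F 0 1)) - (D 2 (F 1 0) - D 0 (F 1 2)) -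
      (D 0 (F 2 1) - D 1 (F 2 0))) := by
    rw [← r0, ← r1, ← r2]
    module
  have c11 : C 1 1 = (1 / 2 : ℝ) • ((D 2 (F 1 0) - D 0 (F 1 2)) - (D 1 (F 0 2) - D 2 (F 0 1)) -
      (D 0 (F 2 1) - D 1 (F 2 0))) := by
    rw [← r0, ← r1, ← r2]
    module
  have c22 : C 2 2 = (1 / 2 : ℝ) • ((D 0 (F 2 1) - D 1 (F 2 0)) - (D 1 (F 0 2) - D 2 (F 0 1)) -
      (D 2 (F 1 0) - D 0 (F 1 2))) := by
    rw [← r0, ← r1, ← r2]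
    module
  have sym : ∀ i j, E i j = (1 / 2 : ℝ) • (E i j + E j i) := by
    intro i j
    rw [hs j i]
    module
  -- Averaging `E i j` with `E j i` leaves only the symmetric part of `F`.
  refine ⟨fun i j => (1 / 2 : ℝ) • (F i j + F j i), fun i j => congrArg _ (add_comm _ _), ?_, ?_, ?_,
    (sym 0 1).trans ?_, (sym 0 2).trans ?_, (sym 1 2).trans ?_⟩
  all_goals
    simp only [hC0, hC1, hC2, c00, c01, c02, c10, c11, c12, c20, c21, c22, map_add, map_sub,
      map_smul, D_one_zero, D_two_zero, D_two_one]
    module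

/-- A trace-free tensor field whose columns are divergence-free is the curl of a symmetric tensor field. -/
theorem exists_symm_eq_curl (h : Fin 3 → Fin 3 → smoothFunctions)
    (ht : h 0 0 + h 1 1 + h 2 2 = 0) (hd : ∀ j, D 0 (h 0 j) + D 1 (h 1 j) + D 2 (h 2 j) = 0) :
    ∃ A : Fin 3 → Fin 3 → smoothFunctions, (∀ i j, A i j = A j i) ∧
      ∀ j, h 0 j = D 1 (A 2 j) - D 2 (A 1 j) ∧ h 1 j = D 2 (A 0 j) - D 0 (A 2 j) ∧
        h 2 j = D 0 (A 1 j) - D 1 (A 0 j) := by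
  choose B hB0 hB1 hB2 using fun j => exists_eq_curl (fun i => h i j) (hd j)
  -- The trace of `h` is the divergence of the axial vector of `B`, so that vector is a curl of some
  -- `ψ`. Subtracting the gradient of `ψ j` from the `j`-th field keeps its curl and cancels the
  -- antisymmetric part.
  obtain ⟨ψ, h0, h1, h2⟩ := exists_eq_curl ![B 2 1 - B 1 2, B 0 2 - B 2 0, B 1 0 - B 0 1] (by
    rw [hB0, hB1, hB2] at ht
    simp only [Matrix.cons_val, map_sub]
    linear_combination (norm := module) (1 : ℝ) • ht)
  simp only [Matrix.cons_val] at h0 h1 h2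
  refine ⟨fun b j => B j b - D b (ψ j), ?_, fun j => ?_⟩
  · have e01 : B 1 0 - D 0 (ψ 1) = B 0 1 - D 1 (ψ 0) := by
      linear_combination (norm := module) (1 : ℝ) • h2
    have e02 : B 2 0 - D 0 (ψ 2) = B 0 2 - D 2 (ψ 0) := by
      linear_combination (norm := module) -(1 : ℝ) • h1
    have e12 : B 2 1 - D 1 (ψ 2) = B 1 2 - D 2 (ψ 1) := by
      linear_combination (norm := module) (1 : ℝ) • h0
    intro i j
    fin_cases i <;> fin_cases j <;> first | rfl | assumption | (symm; assumption)
  · rw [hB0, hB1, hB2]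
    simp only [map_sub, D_one_zero, D_two_zero, D_two_one]
    refine ⟨?_, ?_, ?_⟩ <;> abel

/-! ### Algebraic identities for the operator `P` -/

/-- The second-order part of the operator `P`, on tensor fields with components in the space of
smooth functions. -/
def smoothSecondOrderPart (u : Fin 3 → Fin 3 → smoothFunctions) (j l : Fin 3) : smoothFunctions :=
  ∑ i, D i (D i (u j l)) - (D l (∑ n, D n (u j n)) + D j (∑ n, D n (u l n))) +
    (1 / 2 * delta j l) • ∑ i, ∑ k, D i (D k (u i k))

/-- The operator `P`, on tensor fields with components in the space of smooth functions. -/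
def smoothP (u : Fin 3 → Fin 3 → smoothFunctions) (m l : Fin 3) : smoothFunctions :=
  (1 / 2 : ℝ) • ∑ i, ∑ j, eps m i j • D i (smoothSecondOrderPart u j l)

theorem coe_sum_apply (f : Fin 3 → smoothFunctions) (x : E3) :
    (∑ i, f i : smoothFunctions).1 x = ∑ i, (f i).1 x := by
  simp

theorem coe_smoothSecondOrderPart (u : Fin 3 → Fin 3 → smoothFunctions) (j l : Fin 3) :
    (smoothSecondOrderPart u j l).1 = secondOrderPart (fun i j => (u i j).1) j l := by
  have hdiv : ∀ j : Fin 3, (∑ n, D n (u j n) : smoothFunctions).1 =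
      fun y => ∑ n, pd n (u j n).1 y := fun j => funext fun y => coe_sum_apply _ y
  funext x
  simp only [secondOrderPart]
  rw [← hdiv j, ← hdiv l]
  simp only [smoothSecondOrderPart, laplacian, divdiv, ← coe_D, Submodule.coe_add,
    Submodule.coe_sub, Submodule.coe_smul, Pi.add_apply, Pi.sub_apply, Pi.smul_apply,
    smul_eq_mul, coe_sum_apply]

theorem coe_smoothP (u : Fin 3 → Fin 3 → smoothFunctions) (m l : Fin 3) :
    (smoothP u m l).1 = P (fun i j => (u i j).1) m l := by
  funext x
  simp only [P, ← coe_smoothSecondOrderPart]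
  simp [smoothP, coe_D]

theorem smoothP_zero (u : Fin 3 → Fin 3 → smoothFunctions) (l : Fin 3) :
    smoothP u 0 l = (1 / 2 : ℝ) •
      (D 1 (smoothSecondOrderPart u 2 l) - D 2 (smoothSecondOrderPart u 1 l)) := by
  simp only [smoothP, Fin.sum_univ_three, eps]
  norm_num
  module

theorem smoothP_one (u : Fin 3 → Fin 3 → smoothFunctions) (l : Fin 3) :
    smoothP u 1 l = (1 / 2 : ℝ) •
      (D 2 (smoothSecondOrderPart u 0 l) - D 0 (smoothSecondOrderPart u 2 l)) := by
  simp only [smoothP, Fin.sum_univ_three, eps]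
  norm_num
  module

theorem smoothP_two (u : Fin 3 → Fin 3 → smoothFunctions) (l : Fin 3) :
    smoothP u 2 l = (1 / 2 : ℝ) •
      (D 0 (smoothSecondOrderPart u 1 l) - D 1 (smoothSecondOrderPart u 0 l)) := by
  simp only [smoothP, Fin.sum_univ_three, eps]
  norm_num
  module

theorem div_smoothP (u : Fin 3 → Fin 3 → smoothFunctions) (l : Fin 3) :
    D 0 (smoothP u 0 l) + D 1 (smoothP u 1 l) + D 2 (smoothP u 2 l) = 0 := by
  simp only [smoothP_zero, smoothP_one, smoothP_two, map_smul, map_sub, D_one_zero, D_two_zero,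
    D_two_one]
  module

theorem smoothSecondOrderPart_symm {u : Fin 3 → Fin 3 → smoothFunctions}
    (hs : ∀ i j, u i j = u j i) (j l : Fin 3) :
    smoothSecondOrderPart u j l = smoothSecondOrderPart u l j := by
  have hdelta : delta j l = delta l j := by simp only [delta, eq_comm]
  rw [smoothSecondOrderPart, smoothSecondOrderPart, hs j l, hdelta,
    add_comm (D l (∑ n, D n (u j n)))]

theorem trace_smoothP {u : Fin 3 → Fin 3 → smoothFunctions} (hs : ∀ i j, u i j = u j i) :
    smoothP u 0 0 + smoothP u 1 1 + smoothP u 2 2 = 0 := by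
  simp only [smoothP_zero, smoothP_one, smoothP_two]
  rw [smoothSecondOrderPart_symm hs 1 0, smoothSecondOrderPart_symm hs 2 0,
    smoothSecondOrderPart_symm hs 2 1]
  module

/-- The antisymmetric part of the curl of a symmetric `S` is div S - grad tr S. With `u` trace-free
and q its double divergence, div S = -½ grad q and tr S = -½ q; the coefficient ½ in `S` is what
makes these match. -/
theorem smoothP_symm {u : Fin 3 → Fin 3 → smoothFunctions} (hs : ∀ i j, u i j = u j i)
    (ht : u 0 0 + u 1 1 + u 2 2 = 0) (i j : Fin 3) : smoothP u i j = smoothP u j i := by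
  have h10 := hs 1 0
  have h20 := hs 2 0
  have h21 := hs 2 1
  have h22 : u 2 2 = -(u 0 0 + u 1 1) := by
    linear_combination (norm := module) (1 : ℝ) • ht
  have e01 : smoothP u 0 1 = smoothP u 1 0 := by
    simp only [smoothP_zero, smoothP_one, smoothSecondOrderPart, Fin.sum_univ_three, delta, h10,
      h20, h21, h22, map_add, map_sub, map_neg, map_smul, D_one_zero, D_two_zero, D_two_one,
      Fin.isValue, Fin.reduceEq, ↓reduceIte]
    module
  have e02 : smoothP u 0 2 = smoothP u 2 0 := by
    simp only [smoothP_zero, smoothP_two, smoothSecondOrderPart, Fin.sum_univ_three, delta, h10,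
      h20, h21, h22, map_add, map_sub, map_neg, map_smul, D_one_zero, D_two_zero, D_two_one,
      Fin.isValue, Fin.reduceEq, one_ne_zero, ↓reduceIte]
    module
  have e12 : smoothP u 1 2 = smoothP u 2 1 := by
    simp only [smoothP_one, smoothP_two, smoothSecondOrderPart, Fin.sum_univ_three, delta, h10,
      h20, h21, h22, map_add, map_sub, map_neg, map_smul, D_one_zero, D_two_zero, D_two_one,
      Fin.isValue, Fin.reduceEq, zero_ne_one, ↓reduceIte]
    module
  fin_cases i <;> fin_cases j <;> first | rfl | assumption | (symm; assumption)

/-! ### Existence of potentials -/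

/-- Every TT tensor field has a third-order potential. -/
theorem exists_eq_smoothP (h : Fin 3 → Fin 3 → smoothFunctions) (hs : ∀ i j, h i j = h j i)
    (ht : h 0 0 + h 1 1 + h 2 2 = 0) (hd : ∀ j, D 0 (h 0 j) + D 1 (h 1 j) + D 2 (h 2 j) = 0) :
    ∃ u : Fin 3 → Fin 3 → smoothFunctions, (∀ i j, u i j = u j i) ∧
      u 0 0 + u 1 1 + u 2 2 = 0 ∧ ∀ i j, h i j = smoothP u i j := by
  obtain ⟨A, hA, hc⟩ := exists_symm_eq_curl h ht hd
  have h01 := hs 0 1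
  have h02 := hs 0 2
  have h12 := hs 1 2
  simp only [(hc _).1, (hc _).2.1, (hc _).2.2, hA 1 0, hA 2 0, hA 2 1] at h01 h02 h12
  obtain ⟨w, hw, e00, e11, e22, e01, e02, e12⟩ := exists_eq_inc
    (fun k j => A k j - (if k = j then A 0 0 + A 1 1 + A 2 2 else 0)) (fun i j => by
      rw [hA i j]; simp only [eq_comm]) (fun k => by
      fin_cases k
      · simp only [Fin.zero_eta, Fin.isValue, ↓reduceIte, map_add, map_sub, zero_ne_one,
          Fin.reduceEq, map_zero]
        linear_combination (norm := module) (1 : ℝ) • h12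
      · simp only [Fin.mk_one, Fin.isValue, ↓reduceIte, map_add, map_sub, one_ne_zero,
          Fin.reduceEq, map_zero, hA 1 0]
        linear_combination (norm := module) -(1 : ℝ) • h02
      · simp only [Fin.reduceFinMk, Fin.isValue, ↓reduceIte, map_add, map_sub, Fin.reduceEq,
          map_zero, hA 2 0, hA 2 1]
        linear_combination (norm := module) (1 : ℝ) • h01)
  simp only [Fin.isValue, Fin.reduceEq, zero_ne_one, ↓reduceIte, sub_zero]
    at e00 e11 e22 e01 e02 e12
  -- Inverting A ↦ A - (tr A) δ expresses the diagonal of `A` through the double curl of `w`.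
  have a00 : A 0 0 = (1 / 2 : ℝ) • ((A 0 0 - (A 0 0 + A 1 1 + A 2 2)) -
      (A 1 1 - (A 0 0 + A 1 1 + A 2 2)) - (A 2 2 - (A 0 0 + A 1 1 + A 2 2))) := by module
  have a11 : A 1 1 = (1 / 2 : ℝ) • ((A 1 1 - (A 0 0 + A 1 1 + A 2 2)) -
      (A 0 0 - (A 0 0 + A 1 1 + A 2 2)) - (A 2 2 - (A 0 0 + A 1 1 + A 2 2))) := by module
  have a22 : A 2 2 = (1 / 2 : ℝ) • ((A 2 2 - (A 0 0 + A 1 1 + A 2 2)) -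
      (A 1 1 - (A 0 0 + A 1 1 + A 2 2)) - (A 0 0 - (A 0 0 + A 1 1 + A 2 2))) := by module
  rw [e00, e11, e22] at a00 a11 a22
  -- This is `-2` times the trace-free part of `w`; the factor gives S(u) = 2A + Hess f, and the
  -- trace term, equal to f δ, accounts for the Hessian.
  set u : Fin 3 → Fin 3 → smoothFunctions := fun i j =>
    (-2 : ℝ) • w i j + ((2 / 3 : ℝ) * delta i j) • (w 0 0 + w 1 1 + w 2 2) with hu
  have husymm : ∀ i j, u i j = u j i := fun i j => by simp only [hu, hw i j, delta, eq_comm]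
  have hutr : u 0 0 + u 1 1 + u 2 2 = 0 := by
    simp only [hu, delta, ↓reduceIte]
    module
  obtain ⟨f, hf⟩ : ∃ f, f = (2 / 3 : ℝ) • (w 0 0 + w 1 1 + w 2 2) := ⟨_, rfl⟩
  have key : ∀ j l, smoothSecondOrderPart u j l = (2 : ℝ) • A j l + D j (D l f) := by
    have s00 : smoothSecondOrderPart u 0 0 = (2 : ℝ) • A 0 0 + D 0 (D 0 f) := by
      simp only [smoothSecondOrderPart, Fin.sum_univ_three, a00, hu, hf,
        delta, hw 1 0, hw 2 0, hw 2 1, map_add, map_smul, D_one_zero, D_two_zero, D_two_one,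
        Fin.isValue, Fin.reduceEq, zero_ne_one, one_ne_zero, ↓reduceIte]
      module
    have s11 : smoothSecondOrderPart u 1 1 = (2 : ℝ) • A 1 1 + D 1 (D 1 f) := by
      simp only [smoothSecondOrderPart, Fin.sum_univ_three, a11, hu, hf,
        delta, hw 1 0, hw 2 0, hw 2 1, map_add, map_smul, D_one_zero, D_two_zero, D_two_one,
        Fin.isValue, Fin.reduceEq, zero_ne_one, one_ne_zero, ↓reduceIte]
      module
    have s22 : smoothSecondOrderPart u 2 2 = (2 : ℝ) • A 2 2 + D 2 (D 2 f) := by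
      simp only [smoothSecondOrderPart, Fin.sum_univ_three, a22, hu, hf,
        delta, hw 1 0, hw 2 0, hw 2 1, map_add, map_smul, D_one_zero, D_two_zero, D_two_one,
        Fin.isValue, Fin.reduceEq, zero_ne_one, one_ne_zero, ↓reduceIte]
      module
    have s01 : smoothSecondOrderPart u 0 1 = (2 : ℝ) • A 0 1 + D 0 (D 1 f) := by
      simp only [smoothSecondOrderPart, Fin.sum_univ_three, e01, hu, hf,
        delta, hw 1 0, hw 2 0, hw 2 1, map_add, map_smul, D_one_zero, D_two_zero, D_two_one,
        Fin.isValue, Fin.reduceEq, zero_ne_one, one_ne_zero, ↓reduceIte]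
      module
    have s02 : smoothSecondOrderPart u 0 2 = (2 : ℝ) • A 0 2 + D 0 (D 2 f) := by
      simp only [smoothSecondOrderPart, Fin.sum_univ_three, e02, hu, hf,
        delta, hw 1 0, hw 2 0, hw 2 1, map_add, map_smul, D_one_zero, D_two_zero, D_two_one,
        Fin.isValue, Fin.reduceEq, zero_ne_one, one_ne_zero, ↓reduceIte]
      module
    have s12 : smoothSecondOrderPart u 1 2 = (2 : ℝ) • A 1 2 + D 1 (D 2 f) := by
      simp only [smoothSecondOrderPart, Fin.sum_univ_three, e12, hu, hf,
        delta, hw 1 0, hw 2 0, hw 2 1, map_add, map_smul, D_one_zero, D_two_zero, D_two_one,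
        Fin.isValue, Fin.reduceEq, zero_ne_one, one_ne_zero, ↓reduceIte]
      module
    have swap : ∀ j l, smoothSecondOrderPart u j l = (2 : ℝ) • A j l + D j (D l f) →
        smoothSecondOrderPart u l j = (2 : ℝ) • A l j + D l (D j f) := fun j l hjl => by
      rw [smoothSecondOrderPart_symm husymm, hjl, hA j l, D_comm]
    intro j l
    fin_cases j <;> fin_cases l <;> first | assumption | (apply swap; assumption)
  refine ⟨u, husymm, hutr, fun i j => ?_⟩
  fin_cases i
  all_goals
    simp only [Fin.zero_eta, Fin.mk_one, Fin.reduceFinMk, smoothP_zero, smoothP_one, smoothP_two,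
      (hc j).1, (hc j).2.1, (hc j).2.2, key, map_add, map_smul, D_one_zero, D_two_zero, D_two_one]
    module

/-! ### Transfer to tensor fields, locality and cutoffs -/

open Filter Topology

theorem IsSymTraceFree.exists_smooth {u : TensorField} (hu : IsSymTraceFree u) :
    ∃ w : Fin 3 → Fin 3 → smoothFunctions, u = (fun i j => (w i j).1) ∧
      (∀ i j, w i j = w j i) ∧ w 0 0 + w 1 1 + w 2 2 = 0 := by
  refine ⟨fun i j => ⟨u i j, hu.smooth i j⟩, rfl, fun i j => Subtype.ext (funext (hu.symm i j)),
    Subtype.ext (funext fun x => ?_)⟩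
  have := hu.traceFree x
  rwa [tr, Fin.sum_univ_three] at this

theorem IsTT.exists_potential {h : TensorField} (hh : IsTT h) :
    ∃ u, IsSymTraceFree u ∧ h = P u := by
  obtain ⟨w, rfl, hs, ht⟩ := hh.toIsSymTraceFree.exists_smooth
  obtain ⟨u, hu, hut, hP⟩ := exists_eq_smoothP w hs ht fun j => Subtype.ext (funext fun x => by
    have := hh.transverse j x
    rwa [div, Fin.sum_univ_three] at this)
  refine ⟨fun i j => (u i j).1, ⟨fun i j => contDiff_coe _, fun i j x => by rw [hu i j],
    fun x => ?_⟩, funext fun i => funext fun j => ?_⟩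
  · rw [tr, Fin.sum_univ_three]
    exact congrFun (congrArg Subtype.val hut) x
  · rw [← coe_smoothP, hP]

theorem IsSymTraceFree.isTT_P {u : TensorField} (hu : IsSymTraceFree u) : IsTT (P u) := by
  obtain ⟨w, rfl, hs, ht⟩ := hu.exists_smooth
  refine ⟨⟨fun i j => ?_, fun i j x => ?_, fun x => ?_⟩, fun j x => ?_⟩
  · rw [← coe_smoothP]
    exact contDiff_coe _
  · rw [← coe_smoothP, ← coe_smoothP, smoothP_symm hs ht]
  · simp only [tr, Fin.sum_univ_three, ← coe_smoothP]
    exact congrFun (congrArg Subtype.val (trace_smoothP hs)) x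
  · simp only [div, Fin.sum_univ_three, ← coe_smoothP]
    exact congrFun (congrArg Subtype.val (div_smoothP w j)) x

theorem IsSymTraceFree.cutoff {u : TensorField} (hu : IsSymTraceFree u) {χ : E3 → ℝ}
    (hχ : ContDiff ℝ ∞ χ) : IsSymTraceFree (cutoff χ u) where
  smooth i j := hχ.mul (hu.smooth i j)
  symm i j x := by simp only [Shielding.cutoff, hu.symm i j x]
  traceFree x := by
    have := hu.traceFree x
    rw [tr] at this
    simp only [tr, Shielding.cutoff, ← Finset.mul_sum, this, mul_zero]

theorem pd_zero (i : Fin 3) : pd i (fun _ => 0) = fun _ => 0 := by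
  funext x
  simp [pd]

/-- A pair of TT tensor fields satisfies the linearised vacuum constraint equations. -/
theorem IsTT.isLinearisedVacuumData {h k : TensorField} (hh : IsTT h) (hk : IsTT k) :
    IsLinearisedVacuumData h k where
  smooth_h := hh.smooth
  smooth_k := hk.smooth
  symm_h := hh.symm
  symm_k := hk.symm
  scalarConstraint x := by
    have htr : tr h = fun _ => 0 := funext hh.traceFree
    have hdiv : ∀ i, (fun y => ∑ j, pd j (h i j) y) = fun _ => 0 := fun i => by
      funext y
      rw [← hh.transverse i y, div]
      simp only [show ∀ j, h i j = h j i from fun j => funext (hh.symm i j)]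
    have hd : ∀ i j, Differentiable ℝ (pd j (h i j)) := fun i j =>
      (contDiff_pd (hh.smooth i j) j).differentiable (by simp)
    have hsum : ∀ i, ∑ j, pd i (pd j (h i j)) x = pd i (fun y => ∑ j, pd j (h i j) y) x := by
      intro i
      change _ = fderiv ℝ (fun y => ∑ j, pd j (h i j) y) x (EuclideanSpace.single i 1)
      rw [fderiv_fun_sum fun j _ => hd i j x, sum_apply]
      rfl
    simp only [laplacian, divdiv, hsum, hdiv, htr, pd_zero]
  vectorConstraint i x := by
    simp only [hk.traceFree, zero_mul, sub_zero]
    exact hk.transverse i x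

theorem pd_congr {f g : E3 → ℝ} {x : E3} (h : f =ᶠ[𝓝 x] g) (i : Fin 3) :
    pd i f =ᶠ[𝓝 x] pd i g :=
  h.fderiv.mono fun _ hy => by rw [pd, pd, hy]

theorem sum_congr_nhds {f g : Fin 3 → E3 → ℝ} {x : E3} (h : ∀ i, f i =ᶠ[𝓝 x] g i) :
    (fun y => ∑ i, f i y) =ᶠ[𝓝 x] fun y => ∑ i, g i y := by
  filter_upwards [eventually_all.2 h] with y hy
  exact Finset.sum_congr rfl fun i _ => hy i

theorem secondOrderPart_congr {u v : TensorField} {x : E3} (h : ∀ i j, u i j =ᶠ[𝓝 x] v i j)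
    (j l : Fin 3) : secondOrderPart u j l =ᶠ[𝓝 x] secondOrderPart v j l := by
  have h1 : laplacian (u j l) =ᶠ[𝓝 x] laplacian (v j l) :=
    sum_congr_nhds fun i => pd_congr (pd_congr (h j l) i) i
  have h2 : ∀ j l, pd l (fun y => ∑ n, pd n (u j n) y) =ᶠ[𝓝 x]
      pd l (fun y => ∑ n, pd n (v j n) y) := fun j l =>
    pd_congr (sum_congr_nhds fun n => pd_congr (h j n) n) l
  have h3 : divdiv u =ᶠ[𝓝 x] divdiv v :=
    sum_congr_nhds fun i => sum_congr_nhds fun j => pd_congr (pd_congr (h i j) j) i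
  filter_upwards [h1, h2 j l, h2 l j, h3] with y e1 e2 e3 e4
  simp only [secondOrderPart, e1, e2, e3, e4]

/-- The operator `P` is local. -/
theorem P_congr {u v : TensorField} {x : E3} (h : ∀ i j, u i j =ᶠ[𝓝 x] v i j) (m l : Fin 3) :
    P u m l x = P v m l x := by
  simp only [P]
  congr 1
  refine Finset.sum_congr rfl fun i _ => Finset.sum_congr rfl fun j _ => ?_
  rw [(pd_congr (secondOrderPart_congr h j l) i).self_of_nhds]

theorem P_cutoff_eq_of_eventually_one {u : TensorField} {χ : E3 → ℝ} {x : E3}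
    (h : ∀ᶠ y in 𝓝 x, χ y = 1) (m l : Fin 3) : P (cutoff χ u) m l x = P u m l x :=
  P_congr (fun i j => h.mono fun y hy => by simp only [cutoff, hy, one_mul]) m l

theorem P_zero (m l : Fin 3) (x : E3) : P (fun _ _ _ => 0) m l x = 0 := by
  have : ∀ j l, secondOrderPart (fun _ _ _ => 0) j l = fun _ => 0 := fun j l => funext fun y => by
    simp [secondOrderPart, laplacian, divdiv, pd_zero]
  simp [P, this, pd_zero]

theorem P_cutoff_eq_zero_of_eventually_zero {u : TensorField} {χ : E3 → ℝ} {x : E3}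
    (h : ∀ᶠ y in 𝓝 x, χ y = 0) (m l : Fin 3) : P (cutoff χ u) m l x = 0 :=
  (P_congr (v := fun _ _ _ => 0)
    (fun i j => h.mono fun y hy => by simp only [cutoff, hy, zero_mul]) m l).trans (P_zero m l x)

/-- Locality gives vanishing on the open exterior, and continuity carries it to the closure. The
support of `χ` may reach the boundary of `U`. -/
theorem IsSymTraceFree.P_cutoff_eq_zero_on_closure {u : TensorField} (hu : IsSymTraceFree u)
    {χ : E3 → ℝ} (hχ : ContDiff ℝ ∞ χ) {U : Set E3} (hU : ∀ x ∉ U, χ x = 0) (m l : Fin 3) :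
    ∀ x ∈ closure (closure U)ᶜ, P (Shielding.cutoff χ u) m l x = 0 := by
  have hclosed : IsClosed {x | P (Shielding.cutoff χ u) m l x = 0} :=
    isClosed_eq ((hu.cutoff hχ).isTT_P.smooth m l).continuous continuous_const
  refine fun x hx => closure_minimal (fun y hy => ?_) hclosed hx
  refine P_cutoff_eq_zero_of_eventually_zero ?_ m l
  filter_upwards [isClosed_closure.isOpen_compl.mem_nhds hy] with z hz
  exact hU z fun hzU => hz (subset_closure hzU)

theorem exists_smooth_cutoff {Ω Ω' : Set E3} (hΩ' : IsOpen Ω') (hsub : closure Ω ⊆ Ω') :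
    ∃ χ : E3 → ℝ, ContDiff ℝ ∞ χ ∧ (∀ x ∈ Ω, χ x = 1) ∧ tsupport χ ⊆ Ω' := by
  -- The intermediate `U` will be the exact nonvanishing set of `χ`, so the closed support is
  -- `closure U`, still inside `Ω'`.
  obtain ⟨U, hU, hΩU, hUΩ'⟩ := normal_exists_closure_subset isClosed_closure hΩ' hsub
  obtain ⟨χ, hχ, -, hsupp, hone⟩ := exists_contMDiff_support_eq_eq_one_iff
    (n := ⊤) (modelWithCornersSelf ℝ E3) hU isClosed_closure hΩU
  refine ⟨χ, hχ.contDiff, fun x hx => (hone x).1 (subset_closure hx), ?_⟩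
  rwa [tsupport, hsupp]

end

end Shielding

theorem mainTheorem1 (h k : Shielding.TensorField)
    (hh : Shielding.IsTT h) (hk : Shielding.IsTT k)
    (Ω Ω' : Set Shielding.E3) (hΩ : IsOpen Ω) (hΩ' : IsOpen Ω') (hsub : closure Ω ⊆ Ω') :
    -- third-order potentials exist
    (∃ u v : Shielding.TensorField,
      Shielding.IsSymTraceFree u ∧ Shielding.IsSymTraceFree v ∧
        h = Shielding.P u ∧ k = Shielding.P v) ∧
    -- cutoff functions exist
    (∃ χ : Shielding.E3 → ℝ, ContDiff ℝ ∞ χ ∧ (∀ x ∈ Ω, χ x = 1) ∧ tsupport χ ⊆ Ω') ∧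
    -- shielding, for every choice of the potentials and of the cutoff function
    (∀ u v : Shielding.TensorField,
      Shielding.IsSymTraceFree u → Shielding.IsSymTraceFree v →
      h = Shielding.P u → k = Shielding.P v →
      ∀ χ : Shielding.E3 → ℝ, ContDiff ℝ ∞ χ → (∀ x ∈ Ω, χ x = 1) → (∀ x ∉ Ω', χ x = 0) →
        Shielding.IsTT (Shielding.P (Shielding.cutoff χ u)) ∧
        Shielding.IsTT (Shielding.P (Shielding.cutoff χ v)) ∧
        Shielding.IsLinearisedVacuumData
          (Shielding.P (Shielding.cutoff χ u)) (Shielding.P (Shielding.cutoff χ v)) ∧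
        (∀ x ∈ Ω, ∀ i j, Shielding.P (Shielding.cutoff χ u) i j x = h i j x ∧
          Shielding.P (Shielding.cutoff χ v) i j x = k i j x) ∧
        (∀ x ∈ closure (closure Ω')ᶜ, ∀ i j, Shielding.P (Shielding.cutoff χ u) i j x = 0 ∧
          Shielding.P (Shielding.cutoff χ v) i j x = 0) ∧
        (tsupport χ ⊆ Ω' → ∀ x ∉ Ω', ∀ i j, Shielding.P (Shielding.cutoff χ u) i j x = 0 ∧
          Shielding.P (Shielding.cutoff χ v) i j x = 0)) := by
  refine ⟨?_, Shielding.exists_smooth_cutoff hΩ' hsub, ?_⟩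
  · obtain ⟨u, hu, rfl⟩ := hh.exists_potential
    obtain ⟨v, hv, rfl⟩ := hk.exists_potential
    exact ⟨u, v, hu, hv, rfl, rfl⟩
  · rintro u v hu hv rfl rfl χ hχ hone hzero
    have hTu := (hu.cutoff hχ).isTT_P
    have hTv := (hv.cutoff hχ).isTT_P
    refine ⟨hTu, hTv, hTu.isLinearisedVacuumData hTv, fun x hx i j => ?_, fun x hx i j => ?_,
      fun hsupp x hx i j => ?_⟩
    · have h1 : ∀ᶠ y in nhds x, χ y = 1 := Filter.mem_of_superset (hΩ.mem_nhds hx) hone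
      exact ⟨Shielding.P_cutoff_eq_of_eventually_one h1 i j,
        Shielding.P_cutoff_eq_of_eventually_one h1 i j⟩
    · exact ⟨hu.P_cutoff_eq_zero_on_closure hχ hzero i j x hx,
        hv.P_cutoff_eq_zero_on_closure hχ hzero i j x hx⟩
    · have h0 : ∀ᶠ y in nhds x, χ y = 0 :=
        notMem_tsupport_iff_eventuallyEq.1 fun h => hx (hsupp h)
      exact ⟨Shielding.P_cutoff_eq_zero_of_eventually_zero h0 i j,
        Shielding.P_cutoff_eq_zero_of_eventually_zero h0 i j⟩
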